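/- Let $k$ be a number field, $K/k$ a finite Galois extension with Galois group $G$, and let $\chi$ be a faithful character of $G$, that is, the trace function of a nonzero finite-dimensional complex representation of $G$ with $\{g\in G : \chi(g)=\chi(1)\}=\{1\}$. Let $\tilde K$ be the Galois closure of $K$ over $\mathbb{Q}$, let $\tilde G:=\mathrm{Gal}(\tilde K/\mathbb{Q})$, $U:=\mathrm{Gal}(\tilde K/k)$ and $V:=\mathrm{Gal}(\tilde K/K)$, and identify $G$ with $U/V$. Let $\tilde\chi:U\to\mathbb{C}$, $\tilde\chi(\sigma):=\chi(\sigma V)=\chi(\sigma|_K)$, and let $\tilde\chi^{\tilde G}$ be the character of $\tilde G$ induced from $\tilde\chi$, i.e. $\tilde\chi^{\tilde G}(g)=\frac{1}{|U|}\sum_{x\in\tilde G,\ x^{-1}gx\in U}\tilde\chi(x^{-1}gx)$. Then $\tilde\chi^{\tilde G}$ is a faithful character of $\tilde G$, and $$L(s,\chi,K/k)=L(s,\tilde\chi^{\tilde G},\tilde K/\mathbb{Q}).$$ Here, for a finite Galois extension $N/F$ of number fields and a character $\psi$ of $\mathrm{Gal}(N/F)$ afforded by a representation $\rho$ on $W$,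 the Artin $L$-function $L(s,\psi,N/F)$ is the meromorphic continuation to $\mathbb{C}$ of the Euler product $$\prod_{\mathfrak p}\det\bigl(1-N(\mathfrak p)^{-s}\rho(\mathrm{Frob}_{\mathfrak P})\mid W^{I_{\mathfrak P}}\bigr)^{-1},$$ over all nonzero primes $\mathfrak p$ of $F$, where $\mathfrak P$ is a prime of $N$ above $\mathfrak p$ with inertia group $I_{\mathfrak P}$ and Frobenius $\mathrm{Frob}_{\mathfrak P}$. Both Euler products converge for $\mathrm{Re}(s)>1$. -/

import Mathlib

noncomputable section

namespace ArtinL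

open NumberField IsDedekindDomain

/-! ### Characters of finite groups -/

section Characters

variable {G : Type*} [Group G]

/-- `χ` is a (complex) character of `G`: the trace function of a nonzero finite-dimensional
complex representation of `G`. -/
def IsCharacter (χ : G → ℂ) : Prop :=
  ∃ n : ℕ, 0 < n ∧ ∃ ρ : Representation ℂ G (Fin n → ℂ), ρ.character = χ

/-- The character `χ` is faithful: its kernel `{g | χ g = χ 1}` is trivial. -/
def IsFaithful (χ : G → ℂ) : Prop :=
  ∀ g : G, χ g = χ 1 → g = 1

/-- The degree of a representation chosen to afford the character `χ`. -/
def IsCharacter.degree {χ : G → ℂ} (h : IsCharacter χ) : ℕ := h.choose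

/-- A representation affording the character `χ` (it is unique up to isomorphism when `G` is
finite). -/
def IsCharacter.rep {χ : G → ℂ} (h : IsCharacter χ) :
    Representation ℂ G (Fin h.degree → ℂ) :=
  h.choose_spec.2.choose

theorem IsCharacter.rep_character {χ : G → ℂ} (h : IsCharacter χ) : h.rep.character = χ :=
  h.choose_spec.2.choose_spec

/-- The class function on `G` induced from `ψ : H → ℂ` along an injective homomorphism
`φ : H →* G` of finite groups, so that `H` is identified with a subgroup of `G`:
`g ↦ |H|⁻¹ ∑ x, ψ° (x⁻¹ g x)`, where `ψ°` is the extension of `ψ` by zero to `G`. -/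
def inducedCharacter {H : Type*} [Group H] [Fintype G] (φ : H →* G) (ψ : H → ℂ) (g : G) : ℂ :=
  (Nat.card H : ℂ)⁻¹ * ∑ x : G, Function.extend φ ψ 0 (x⁻¹ * g * x)

end Characters

/-! ### Euler factors -/

section EulerFactor

open scoped Pointwise

variable (k : Type*) {K : Type*} [Field k] [NumberField k] [Field K] [NumberField K]
  [Algebra k K] [IsGalois k K]
variable {V : Type*} [AddCommGroup V] [Module ℂ V]

/-- The space `V ^ I_Q` of vectors fixed by the inertia group of the prime `Q`. -/
def inertiaInvariants (ρ : Representation ℂ Gal(K/k) V) (Q : Ideal (𝓞 K)) : Submodule ℂ V :=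
  Representation.invariants (ρ.comp (Q.inertia Gal(K/k)).subtype)

theorem frob_mem_inertiaInvariants (ρ : Representation ℂ Gal(K/k) V) (Q : Ideal (𝓞 K))
    [Q.IsPrime] [Finite (𝓞 K ⧸ Q)] :
    ∀ v ∈ inertiaInvariants k ρ Q,
      ρ (arithFrobAt (𝓞 k) Gal(K/k) Q) v ∈ inertiaInvariants k ρ Q := by
  intro v hv
  set φ := arithFrobAt (𝓞 k) Gal(K/k) Q with hφ
  have hst : φ ∈ MulAction.stabilizer Gal(K/k) Q :=
    IsArithFrobAt.arithFrobAt_mem_stabilizer (𝓞 k) Gal(K/k) Q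
  rintro ⟨τ, hτ⟩
  have hconj : φ⁻¹ * τ * φ ∈ Q.inertia Gal(K/k) := by
    intro x
    have h2 := Ideal.smul_mem_pointwise_smul φ⁻¹ _ Q (hτ (φ • x))
    rw [MulAction.mem_stabilizer_iff.mp (inv_mem hst)] at h2
    simpa [mul_smul, smul_sub] using h2
  have h3 : ρ (φ⁻¹ * τ * φ) v = v := hv ⟨_, hconj⟩
  change ρ τ (ρ φ v) = ρ φ v
  conv_rhs => rw [← h3]
  simp only [← Module.End.mul_apply, ← map_mul]
  congr 2
  group

/-- The action of a Frobenius automorphism at the prime `Q` on `V ^ I_Q`. -/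
def frobOnInvariants (ρ : Representation ℂ Gal(K/k) V) (Q : Ideal (𝓞 K))
    [Q.IsPrime] [Finite (𝓞 K ⧸ Q)] :
    inertiaInvariants k ρ Q →ₗ[ℂ] inertiaInvariants k ρ Q :=
  (ρ (arithFrobAt (𝓞 k) Gal(K/k) Q)).restrict (frob_mem_inertiaInvariants k ρ Q)

/-- A prime of `K` above the prime `p` of `k` (all of them are conjugate). -/
def primeAbove (k K : Type*) [Field k] [NumberField k] [Field K] [NumberField K]
    [Algebra k K] (p : HeightOneSpectrum (𝓞 k)) : p.asIdeal.primesOver (𝓞 K) :=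
  Classical.arbitrary _

/-- The Euler factor `det (1 - N(p) ^ (-s) Frob_Q | V ^ I_Q)⁻¹` at the prime `p` of `k`, where
`Q` is a prime of `K` above `p`. -/
def repEulerFactor (ρ : Representation ℂ Gal(K/k) V) (p : HeightOneSpectrum (𝓞 k)) (s : ℂ) : ℂ :=
  (LinearMap.det (LinearMap.id -
    ((Ideal.absNorm p.asIdeal : ℂ) ^ (-s)) • frobOnInvariants k ρ (primeAbove k K p).1))⁻¹

end EulerFactor

/-! ### Artin L-functions -/

section LFunction

variable (k K : Type*) [Field k] [NumberField k] [Field K] [NumberField K]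
  [Algebra k K] [IsGalois k K]

open Classical in
/-- The Euler factor at `p` of the Artin L-function of the character `χ` of `Gal(K/k)`, computed
from a representation affording `χ` (and `1` by convention if `χ` is not a character). -/
def eulerFactor (χ : Gal(K/k) → ℂ) (p : HeightOneSpectrum (𝓞 k)) (s : ℂ) : ℂ :=
  if h : IsCharacter χ then repEulerFactor k h.rep p s else 1

/-- The Artin Euler product over all nonzero primes of `k`; it converges for `1 < re s`. -/
def eulerProduct (χ : Gal(K/k) → ℂ) (s : ℂ) : ℂ :=
  ∏' p : HeightOneSpectrum (𝓞 k), eulerFactor k K χ p s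

/-- `f` is a meromorphic continuation of the Artin Euler product of `χ` to the whole plane.
(The normal form fixes the value `0` at poles and removes removable singularities, so that there
is at most one such function.) -/
def IsContinuation (χ : Gal(K/k) → ℂ) (f : ℂ → ℂ) : Prop :=
  MeromorphicNFOn f Set.univ ∧ ∀ s : ℂ, 1 < s.re → f s = eulerProduct k K χ s

open Classical in
/-- The Artin L-function `s ↦ L(s, χ, K/k)`: the meromorphic continuation to `ℂ` of the Euler
product on `1 < re s` (with value `0` at poles). A continuation always exists, by Brauer; the
alternative branch, the Euler product extended by zero, only makes the definition total. -/
def artinLFunction (χ : Gal(K/k) → ℂ) : ℂ → ℂ :=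
  if h : ∃ f : ℂ → ℂ, IsContinuation k K χ f then h.choose
  else fun s => if 1 < s.re then eulerProduct k K χ s else 0

end LFunction

/-! ### Inflation and induction along a tower `ℚ ⊆ k ⊆ K ⊆ K'` -/

section Tower

variable {k K : Type*} (K' : Type*) [Field k] [Field K] [Field K'] [Algebra k K]
  [Algebra k K'] [Algebra K K'] [IsScalarTower k K K']

/-- The inflation of `χ : Gal(K/k) → ℂ` to `Gal(K'/k)`, `σ ↦ χ (σ|_K)`. -/
def inflation [Normal k K] (χ : Gal(K/k) → ℂ) : Gal(K'/k) → ℂ :=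
  fun σ => χ (AlgEquiv.restrictNormalHom K σ)

/-- The inflation of `χ` to `Gal(K'/k)`, induced to `Gal(K'/ℚ)`; here `Gal(K'/k)` is the subgroup
of `Gal(K'/ℚ)` of automorphisms that fix `k`. -/
def inducedInflation [Normal k K] [NumberField k] [NumberField K'] (χ : Gal(K/k) → ℂ) :
    Gal(K'/ℚ) → ℂ :=
  inducedCharacter (AlgEquiv.restrictScalarsHom ℚ : Gal(K'/k) →* Gal(K'/ℚ)) (inflation K' χ)

end Tower

end ArtinL

end

/-! For `Re s > 0` the Euler factor at a prime `p` of the base field is the exponential of the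
series with terms `N(p)^(-ns) / n * tr(Frob ^ n | V^I)`. That trace is the average `frobAvg` of the
character over the coset `I * Frob ^ n`, that is, over the automorphisms acting as `x ↦ x ^ (N(p) ^
n)` modulo the chosen prime above `p`. The last description (`frobClass`) involves only an exponent
and a prime of the top field, so classes over `ℚ` and over `k` can be compared with the same
exponent `l ^ j`, where `l` is the norm of a rational prime `P`.

The class over `k` at `p ∣ P` is empty unless the inertia degree `f_p` divides `j`
(`dvd_of_mem_frobClass`), so the logarithm at `p` is a series in `l ^ (-s)` with coefficients `f_p /
j * frobAvg` (`hasSum_eulerLog_rat`). Averages do not change under inflation, because restriction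
maps inertia groups onto inertia groups (`frobAvg_inflation`). For an induced character, the sum
over conjugates becomes a sum over the primes of `K'` above `P`. Grouping these by the prime `p` of
`k` gives `∑ f_p * frobAvg` (`frobAvg_inducedInflation`). Hence the logarithm at `P` is the sum of
those at the `p ∣ P`. For `Re s > 1` everything converges absolutely, the products agree, and with
them the continuations.

The induced character is afforded by equivariant functions. If it takes its value at `1` on `g`,
equality in the triangle inequality forces every conjugate of `g` into `Gal(K'/k)` and into the
kernel of the inflation. So `g` fixes all conjugates of `K`, and these generate `K'`. -/

noncomputable section

namespace ArtinL

open NumberField IsDedekindDomain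

/-! ### Endomorphisms of finite order. -/

section LinearAlgebra

variable {V : Type*} [AddCommGroup V] [Module ℂ V]

theorem toMatrix_pow_eq_diagonal {ι : Type*} [Fintype ι] [DecidableEq ι] {A : Module.End ℂ V}
    (b : Module.Basis ι ℂ V) {μ : ι → ℂ} (h : ∀ i, A (b i) = μ i • b i) (n : ℕ) :
    LinearMap.toMatrix b b (A ^ n) = Matrix.diagonal (μ ^ n) := by
  rw [← Matrix.diagonal_pow]
  refine (map_pow (LinearMap.toMatrixAlgEquiv b) A n).trans (congrArg (· ^ n) ?_)
  change LinearMap.toMatrix b b A = _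
  ext i j
  rw [LinearMap.toMatrix_apply, h, map_smul, Module.Basis.repr_self, Matrix.diagonal_apply]
  simp only [Finsupp.smul_single, smul_eq_mul, mul_one, Finsupp.single_apply]
  grind

theorem trace_pow_eq_sum {ι : Type*} [Fintype ι] {A : Module.End ℂ V}
    (b : Module.Basis ι ℂ V) {μ : ι → ℂ} (h : ∀ i, A (b i) = μ i • b i) (n : ℕ) :
    LinearMap.trace ℂ V (A ^ n) = ∑ i, μ i ^ n := by
  classical
  rw [LinearMap.trace_eq_matrix_trace ℂ b, toMatrix_pow_eq_diagonal b h, Matrix.trace_diagonal]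
  rfl

theorem det_id_sub_smul_eq_prod {ι : Type*} [Fintype ι] {A : Module.End ℂ V}
    (b : Module.Basis ι ℂ V) {μ : ι → ℂ} (h : ∀ i, A (b i) = μ i • b i) (t : ℂ) :
    LinearMap.det (LinearMap.id - t • A) = ∏ i, (1 - t * μ i) := by
  classical
  have hA := toMatrix_pow_eq_diagonal b h 1
  rw [pow_one, pow_one] at hA
  rw [← LinearMap.det_toMatrix b, map_sub, map_smul, hA, LinearMap.toMatrix_id,
    ← Matrix.diagonal_one, ← Matrix.diagonal_smul, Matrix.diagonal_sub, Matrix.det_diagonal]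
  rfl

variable [FiniteDimensional ℂ V]

/-- An endomorphism of finite order of a complex vector space is diagonalizable, and its
eigenvalues have absolute value one. -/
theorem exists_eigenbasis {A : Module.End ℂ V} (hA : IsOfFinOrder A) :
    ∃ (b : Module.Basis (Fin (Module.finrank ℂ V)) ℂ V) (μ : Fin (Module.finrank ℂ V) → ℂ),
      (∀ i, A (b i) = μ i • b i) ∧ ∀ i, ‖μ i‖ = 1 := by
  obtain ⟨m, hm, hAm⟩ := isOfFinOrder_iff_pow_eq_one.mp hA
  have hss : A.IsSemisimple := by
    refine Module.End.isSemisimple_of_squarefree_aeval_eq_zero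
      (p := Polynomial.X ^ m - Polynomial.C 1) ?_ (by simp [hAm])
    exact (Polynomial.separable_X_pow_sub_C (1 : ℂ) (by exact_mod_cast hm.ne')
      one_ne_zero).squarefree
  have hspan : ⊤ ≤ Submodule.span ℂ {v : V | ∃ μ : ℂ, A v = μ • v} := by
    rw [← hss.iSup_eigenspace_eq_top, iSup_le_iff]
    intro μ v hv
    exact Submodule.subset_span ⟨μ, Module.End.mem_eigenspace_iff.mp hv⟩
  let b₀ := Module.Basis.ofSpan hspan
  let b := b₀.reindex (b₀.indexEquiv (Module.finBasis ℂ V))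
  have hb (i) : ∃ μ : ℂ, A (b i) = μ • b i := by
    rw [Module.Basis.reindex_apply]
    exact Module.Basis.ofSpan_subset hspan ⟨_, rfl⟩
  choose μ hμ using hb
  refine ⟨b, μ, hμ, fun i => ?_⟩
  have hpow (n : ℕ) : (A ^ n) (b i) = μ i ^ n • b i := by
    induction n with
    | zero => simp
    | succ n ih => rw [pow_succ', Module.End.mul_apply, ih, map_smul, hμ, smul_smul, pow_succ]
  have h1 : μ i ^ m • b i = (1 : ℂ) • b i := by rw [← hpow, hAm]; simp
  exact Complex.norm_eq_one_of_pow_eq_one (smul_left_injective ℂ (b.ne_zero i) h1) hm.ne'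

theorem norm_trace_le {A : Module.End ℂ V} (hA : IsOfFinOrder A) :
    ‖LinearMap.trace ℂ V A‖ ≤ Module.finrank ℂ V := by
  obtain ⟨b, μ, hb, hμ⟩ := exists_eigenbasis hA
  rw [← pow_one A, trace_pow_eq_sum b hb]
  refine (norm_sum_le _ _).trans ?_
  simp [hμ]

/-- For `A` of finite order, `exp (∑ tr (Aⁿ) tⁿ / n) = det (1 - t A)⁻¹` when `|t| < 1`. -/
theorem exists_hasSum_trace_pow {A : Module.End ℂ V} (hA : IsOfFinOrder A) {t : ℂ}
    (ht : ‖t‖ < 1) :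
    ∃ L : ℂ, HasSum (fun n : ℕ => t ^ n / n * LinearMap.trace ℂ V (A ^ n)) L ∧
      Complex.exp L = (LinearMap.det (LinearMap.id - t • A))⁻¹ := by
  obtain ⟨b, μ, hb, hμ⟩ := exists_eigenbasis hA
  have hlt (i) : ‖t * μ i‖ < 1 := by rwa [norm_mul, hμ, mul_one]
  refine ⟨∑ i, -Complex.log (1 - t * μ i), ?_, ?_⟩
  -- The term `n = 0` is zero because division by zero gives zero, as in the Taylor series of the
  -- logarithm.
  · convert! hasSum_sum fun i (_ : i ∈ Finset.univ) =>
      Complex.hasSum_taylorSeries_neg_log (hlt i) using 2 with n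
    rw [trace_pow_eq_sum b hb, Finset.mul_sum]
    refine Finset.sum_congr rfl fun i _ => ?_
    rw [mul_pow]
    ring
  · rw [det_id_sub_smul_eq_prod b hb, Complex.exp_sum, ← Finset.prod_inv_distrib]
    refine Finset.prod_congr rfl fun i _ => ?_
    rw [Complex.exp_neg, Complex.exp_log]
    intro h0
    have := hlt i
    rw [← sub_eq_zero.mp h0] at this
    simp at this

end LinearAlgebra

/-! ### Characters and traces on invariants. -/

section Representations

variable {G : Type*} [Group G] {V : Type*} [AddCommGroup V] [Module ℂ V] [FiniteDimensional ℂ V]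

theorem norm_character_le [Finite G] (ρ : Representation ℂ G V) (g : G) :
    ‖ρ.character g‖ ≤ Module.finrank ℂ V :=
  norm_trace_le (MonoidHom.isOfFinOrder ρ (isOfFinOrder_of_finite g))

/-- The trace on the invariants of a finite group is the average of traces. -/
theorem trace_restrict_invariants [Fintype G] (ρ : Representation ℂ G V) (A : Module.End ℂ V)
    (hA : ∀ v ∈ ρ.invariants, A v ∈ ρ.invariants) :
    LinearMap.trace ℂ ρ.invariants (A.restrict hA) =
      (Nat.card G : ℂ)⁻¹ * ∑ g, LinearMap.trace ℂ V (A * ρ g) := by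
  have : Invertible (Fintype.card G : ℂ) :=
    invertibleOfNonzero (by exact_mod_cast Fintype.card_ne_zero)
  -- Averaging is the identity on invariants, so it may be inserted before `A`; the composite maps
  -- all of `V` into the invariants, hence has the same trace on `V` as on the subspace.
  have hmem (v) : (A * ρ.averageMap) v ∈ ρ.invariants := hA _ (ρ.averageMap_invariant v)
  have hres : A.restrict hA = (A * ρ.averageMap).restrict (fun v _ => hmem v) := by
    ext v
    simp only [LinearMap.coe_restrict_apply, Module.End.mul_apply]
    rw [ρ.averageMap_id v v.2]
  rw [hres, LinearMap.trace_restrict_eq_of_forall_mem _ _ hmem, Nat.card_eq_fintype_card]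
  have havg : ρ.averageMap = (Fintype.card G : ℂ)⁻¹ • ∑ g, ρ g := by
    simp [Representation.averageMap, GroupAlgebra.average, map_sum]
  rw [havg, mul_smul_comm, map_smul, Finset.mul_sum, map_sum, smul_eq_mul]

/-- A representation on an arbitrary nonzero finite-dimensional space affords a character. -/
theorem isCharacter_character [Nontrivial V] (ρ : Representation ℂ G V) :
    IsCharacter ρ.character := by
  let e := (Module.finBasis ℂ V).equivFun
  refine ⟨Module.finrank ℂ V, Module.finrank_pos, (e.conjRingEquiv : _ →* _).comp ρ, ?_⟩
  ext g
  exact LinearMap.trace_conj' (ρ g) e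

end Representations

/-! ### Induced representations and kernels of induced characters. -/

section Induction

variable {G H : Type*} [Group G] [Group H] {V : Type*} [AddCommGroup V] [Module ℂ V]

/-- The action of `G × H` on functions `f : G → V`, by left translation by `G` and by right
translation along `φ : H →* G` combined with a representation `ρ` of `H`. -/
def functionRep (φ : H →* G) (ρ : Representation ℂ H V) : Representation ℂ (G × H) (G → V) where
  toFun a :=
    { toFun f x := ρ a.2 (f (a.1⁻¹ * x * φ a.2))
      map_add' _ _ := by ext; simp
      map_smul' _ _ := by ext; simp }
  map_one' := by ext; simp
  map_mul' a b := by
    ext v x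
    simp [mul_assoc]

theorem functionRep_apply (φ : H →* G) (ρ : Representation ℂ H V) (a : G × H) (f : G → V) (x : G) :
    functionRep φ ρ a f x = ρ a.2 (f (a.1⁻¹ * x * φ a.2)) := rfl

/-- The left action of `G` commutes with the twisted right action of `H`. -/
theorem functionRep_mem_invariants (φ : H →* G) (ρ : Representation ℂ H V) (g : G) :
    ∀ v ∈ Representation.invariants ((functionRep φ ρ).comp (MonoidHom.inr G H)),
      functionRep φ ρ (g, 1) v ∈
        Representation.invariants ((functionRep φ ρ).comp (MonoidHom.inr G H)) := by
  intro v hv h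
  have h1 : functionRep φ ρ (1, h) v = v := hv h
  change functionRep φ ρ (1, h) (functionRep φ ρ (g, 1) v) = functionRep φ ρ (g, 1) v
  conv_rhs => rw [← h1]
  rw [← Module.End.mul_apply, ← Module.End.mul_apply, ← map_mul, ← map_mul, Prod.mk_mul_mk,
    Prod.mk_mul_mk]
  simp only [one_mul, mul_one]

/-- The representation of `G` induced from the representation `ρ` of `H`, realized on the
functions `G → V` that are equivariant for `H`. -/
def inducedRep (φ : H →* G) (ρ : Representation ℂ H V) :
    Representation ℂ G
      (Representation.invariants ((functionRep φ ρ).comp (MonoidHom.inr G H))) where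
  toFun g := (functionRep φ ρ (g, 1)).restrict (functionRep_mem_invariants φ ρ g)
  map_one' := by
    ext1 v
    refine Subtype.ext ?_
    change functionRep φ ρ 1 v.1 = v.1
    rw [map_one, Module.End.one_apply]
  map_mul' a b := by
    ext1 v
    refine Subtype.ext ?_
    change functionRep φ ρ (a * b, 1) v.1 = (functionRep φ ρ (a, 1) * functionRep φ ρ (b, 1)) v.1
    rw [← map_mul, Prod.mk_mul_mk, mul_one]

/-- The trace of a monomial operator on a function space. -/
theorem trace_eq_sum_fixed {X : Type*} [Fintype X] [DecidableEq X] [FiniteDimensional ℂ V]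
    (T : Module.End ℂ V) (π : X → X) (A : Module.End ℂ (X → V)) (hA : ∀ f x, A f x = T (f (π x))) :
    LinearMap.trace ℂ (X → V) A = ∑ x, if π x = x then LinearMap.trace ℂ V T else 0 := by
  -- Split `A` into its rows. By cyclicity the row of `x` has the trace of its diagonal block, which
  -- is `T` if `π x = x` and zero otherwise.
  have hsum : A = ∑ x, (LinearMap.single ℂ (fun _ : X => V) x) ∘ₗ
      (T ∘ₗ LinearMap.proj (π x)) := by
    refine LinearMap.ext fun f => funext fun y => ?_
    simp [hA, Finset.sum_apply, Pi.single_apply]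
  rw [hsum, map_sum]
  refine Finset.sum_congr rfl fun x _ => ?_
  rw [LinearMap.trace_comp_comm']
  split_ifs with h
  · congr 1
    ext v
    simp [h]
  · rw [← map_zero (LinearMap.trace ℂ V)]
    congr 1
    ext v
    simp [h]

theorem IsCharacter.comp {K : Type*} [Group K] {χ : H → ℂ} (hχ : IsCharacter χ) (f : K →* H) :
    IsCharacter (χ ∘ f) := by
  obtain ⟨n, hn, ρ, rfl⟩ := hχ
  exact ⟨n, hn, ρ.comp f, rfl⟩

variable [Fintype H] {φ : H →* G}

theorem extend_eq_sum [DecidableEq G] (hφ : Function.Injective φ) (ψ : H → ℂ) (y : G) :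
    Function.extend φ ψ 0 y = ∑ h, if φ h = y then ψ h else 0 := by
  by_cases hy : ∃ h, φ h = y
  · obtain ⟨h, rfl⟩ := hy
    rw [hφ.extend_apply]
    rw [Finset.sum_eq_single h (fun b _ hb => if_neg (hφ.ne hb)) (by simp), if_pos rfl]
  · rw [Function.extend_apply' _ _ _ hy, Finset.sum_eq_zero]
    · rfl
    · intro h _
      rw [if_neg fun he => hy ⟨h, he⟩]

/-- The trace of `g` on the `H`-invariants is the average over `h` of the trace of `(g, h)` on all
functions. That operator is monomial, and it fixes the index `x` exactly when `φ h = x⁻¹ * g * x`.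
-/
theorem inducedRep_character [Fintype G] [FiniteDimensional ℂ V] (hφ : Function.Injective φ)
    (ρ : Representation ℂ H V) :
    (inducedRep φ ρ).character = inducedCharacter φ ρ.character := by
  classical
  ext g
  refine (trace_restrict_invariants _ _ (functionRep_mem_invariants φ ρ g)).trans ?_
  rw [inducedCharacter]
  congr 1
  simp_rw [extend_eq_sum hφ]
  rw [Finset.sum_comm]
  refine Finset.sum_congr rfl fun h _ => ?_
  rw [trace_eq_sum_fixed (ρ h) (fun x => g⁻¹ * x * φ h)]
  · refine Finset.sum_congr rfl fun x _ => if_congr ?_ rfl rfl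
    rw [mul_assoc, inv_mul_eq_iff_eq_mul, ← eq_inv_mul_iff_mul_eq, mul_assoc]
  · intro f x
    rw [MonoidHom.comp_apply, ← map_mul, functionRep_apply]
    simp

theorem inducedCharacter_one [Fintype G] (hφ : Function.Injective φ) (ψ : H → ℂ) :
    inducedCharacter φ ψ 1 = (Nat.card H : ℂ)⁻¹ * (Nat.card G * ψ 1) := by
  have : Function.extend φ ψ 0 1 = ψ 1 := by rw [← map_one φ, hφ.extend_apply]
  simp [inducedCharacter, this]

theorem IsCharacter.induced [Fintype G] (hφ : Function.Injective φ) {χ : H → ℂ}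
    (hχ : IsCharacter χ) : IsCharacter (inducedCharacter φ χ) := by
  obtain ⟨n, hn, ρ, rfl⟩ := hχ
  rw [← inducedRep_character hφ ρ]
  -- The induced space is nonzero because its dimension is `|G| * n / |H|`.
  have hne : (inducedRep φ ρ).character 1 ≠ 0 := by
    rw [inducedRep_character hφ, inducedCharacter_one hφ, Representation.char_one]
    simp [hn.ne']
  rw [Representation.char_one, Nat.cast_ne_zero] at hne
  have := Module.nontrivial_of_finrank_pos (Nat.pos_of_ne_zero hne)
  exact isCharacter_character _

/-- The kernel of an induced character lies in all conjugates of the kernel of the character. -/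
theorem exists_of_inducedCharacter_eq [Fintype G] (hφ : Function.Injective φ) {χ : H → ℂ}
    (hχ : IsCharacter χ) {g : G} (hg : inducedCharacter φ χ g = inducedCharacter φ χ 1) (x : G) :
    ∃ h, φ h = x⁻¹ * g * x ∧ χ h = χ 1 := by
  obtain ⟨d, hd, ρ, rfl⟩ := hχ
  set c := Function.extend φ ρ.character 0 with hc
  have h1 : ρ.character 1 = d := by simp
  have hnorm (y) : ‖c y‖ ≤ d := by
    by_cases hy : ∃ h, φ h = y
    · obtain ⟨h, rfl⟩ := hy
      rw [hc, hφ.extend_apply]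
      simpa using norm_character_le ρ h
    · rw [hc, Function.extend_apply' _ _ _ hy]
      simp
  have hre (y) : (c y).re ≤ d := (Complex.re_le_norm _).trans (hnorm y)
  have hsum : ∑ x, c (x⁻¹ * g * x) = ∑ _x : G, (d : ℂ) := by
    rw [inducedCharacter_one hφ, inducedCharacter, h1] at hg
    have := mul_left_cancel₀ (inv_ne_zero (by exact_mod_cast Nat.card_pos.ne')) hg
    simpa using this
  have hsum' : ∑ x, (c (x⁻¹ * g * x)).re = ∑ _x : G, (d : ℝ) := by
    simpa using congrArg Complex.re hsum
  -- Real parts at most `d` that add up to `|G| * d` all equal `d`; as the modulus is also at most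
  -- `d`, each value is `d` itself.
  have hx := (Finset.sum_eq_sum_iff_of_le fun x _ => hre (x⁻¹ * g * x)).mp hsum' x
    (Finset.mem_univ x)
  have hcx : c (x⁻¹ * g * x) = d := by
    have h2 : ‖c (x⁻¹ * g * x)‖ = (c (x⁻¹ * g * x)).re :=
      le_antisymm ((hnorm _).trans hx.ge) (Complex.re_le_norm _)
    refine Complex.ext (by simpa using hx) ?_
    simpa using (Complex.nonneg_iff.mp (Complex.re_eq_norm.mp h2.symm)).2.symm
  by_cases hy : ∃ h, φ h = x⁻¹ * g * x
  · obtain ⟨h, hh⟩ := hy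
    refine ⟨h, hh, ?_⟩
    rw [h1, ← hcx, ← hh, hc, hφ.extend_apply]
  · rw [hc, Function.extend_apply' _ _ _ hy] at hcx
    exact absurd hcx.symm (by simpa using hd.ne')

end Induction

/-! ### Automorphisms acting as a power map modulo a prime. -/

section FrobeniusClasses

open scoped Pointwise

variable (F : Type*) {N : Type*} [Field F] [Field N] [Algebra F N]

/-- The automorphisms that act as `x ↦ x ^ M` modulo `Q`. -/
def frobClass (Q : Ideal (𝓞 N)) (M : ℕ) : Set Gal(N/F) := {σ | ∀ x : 𝓞 N, σ • x - x ^ M ∈ Q}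

variable {F} {Q : Ideal (𝓞 N)}

theorem mem_frobClass {M : ℕ} {σ : Gal(N/F)} :
    σ ∈ frobClass F Q M ↔ ∀ x : 𝓞 N, σ • x - x ^ M ∈ Q := Iff.rfl

theorem mem_frobClass_one {σ : Gal(N/F)} : σ ∈ frobClass F Q 1 ↔ σ ∈ Q.inertia Gal(N/F) := by
  simp only [mem_frobClass, pow_one]
  rfl

theorem mul_mem_frobClass {M₁ M₂ : ℕ} {σ τ : Gal(N/F)} (hσ : σ ∈ frobClass F Q M₁)
    (hτ : τ ∈ frobClass F Q M₂) : σ * τ ∈ frobClass F Q (M₁ * M₂) := by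
  intro x
  have h2 := Ideal.Quotient.eq.mpr (hτ x)
  have h1 := Ideal.Quotient.eq.mpr (hσ (τ • x))
  rw [map_pow, h2, ← map_pow, ← pow_mul, mul_comm M₂] at h1
  rw [mul_smul]
  exact Ideal.Quotient.eq.mp h1

theorem pow_mem_frobClass {M : ℕ} {σ : Gal(N/F)} (hσ : σ ∈ frobClass F Q M) (n : ℕ) :
    σ ^ n ∈ frobClass F Q (M ^ n) := by
  induction n with
  | zero => exact mem_frobClass_one.mpr (one_mem _)
  | succ n ih => exact mul_mem_frobClass ih hσ

theorem mul_inv_mem_inertia {M : ℕ} {σ τ : Gal(N/F)} (hσ : σ ∈ frobClass F Q M)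
    (hτ : τ ∈ frobClass F Q M) : σ * τ⁻¹ ∈ Q.inertia Gal(N/F) := by
  intro x
  simpa [mul_smul] using sub_mem (hσ (τ⁻¹ • x)) (hτ (τ⁻¹ • x))

theorem conj_mem_frobClass_iff {M : ℕ} {σ : Gal(N/F)} (g : Gal(N/F)) :
    σ ∈ frobClass F (g • Q) M ↔ g⁻¹ * σ * g ∈ frobClass F Q M := by
  have h (x : 𝓞 N) : σ • (g • x) - (g • x) ^ M ∈ g • Q ↔ (g⁻¹ * σ * g) • x - x ^ M ∈ Q := by
    rw [Ideal.mem_pointwise_smul_iff_inv_smul_mem, smul_sub, smul_pow', inv_smul_smul, mul_smul,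
      mul_smul]
  refine ⟨fun H x => (h x).mp (H _), fun H x => ?_⟩
  simpa using (h (g⁻¹ • x)).mpr (H _)

theorem card_inertia_smul (g : Gal(N/F)) (Q : Ideal (𝓞 N)) :
    Nat.card ((g • Q).inertia Gal(N/F)) = Nat.card (Q.inertia Gal(N/F)) := by
  refine Nat.card_congr ((MulAut.conj g⁻¹).toEquiv.subtypeEquiv fun σ => ?_)
  rw [← mem_frobClass_one, conj_mem_frobClass_iff, mem_frobClass_one]
  simp

variable [NumberField F] [NumberField N]

/-- The value `|I_Q|⁻¹ ∑ χ σ`, over the `σ` that act as `x ↦ x ^ M` modulo `Q`. -/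
def frobAvg (χ : Gal(N/F) → ℂ) (Q : Ideal (𝓞 N)) (M : ℕ) : ℂ :=
  (Nat.card (Q.inertia Gal(N/F)) : ℂ)⁻¹ * ∑ σ, (frobClass F Q M).indicator χ σ

theorem card_inertia_ne_zero : (Nat.card (Q.inertia Gal(N/F)) : ℂ) ≠ 0 :=
  Nat.cast_ne_zero.mpr Nat.card_pos.ne'

/-- A nonempty class is a right coset of the inertia group. -/
theorem sum_indicator_frobClass (χ : Gal(N/F) → ℂ) {M : ℕ} {φ : Gal(N/F)}
    (hφ : φ ∈ frobClass F Q M) [Fintype (Q.inertia Gal(N/F))] :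
    ∑ σ, (frobClass F Q M).indicator χ σ = ∑ τ : Q.inertia Gal(N/F), χ (τ * φ) := by
  classical
  rw [Finset.sum_indicator_eq_sum_filter]
  symm
  refine Finset.sum_bij (fun τ _ => τ.1 * φ) ?_ ?_ ?_ (fun _ _ => rfl)
  · intro τ _
    have := mul_mem_frobClass (mem_frobClass_one.mpr τ.2) hφ
    rw [one_mul] at this
    simpa using this
  · intro τ _ τ' _ h
    exact Subtype.ext (mul_right_cancel h)
  · intro σ hσ
    have hσ' : σ ∈ frobClass F Q M := by simpa using hσ
    exact ⟨⟨σ * φ⁻¹, mul_inv_mem_inertia hσ' hφ⟩, Finset.mem_univ _, by simp⟩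

theorem frobAvg_of_mem (χ : Gal(N/F) → ℂ) {M : ℕ} {φ : Gal(N/F)}
    (hφ : φ ∈ frobClass F Q M) [Fintype (Q.inertia Gal(N/F))] :
    frobAvg χ Q M = (Nat.card (Q.inertia Gal(N/F)) : ℂ)⁻¹ *
      ∑ τ : Q.inertia Gal(N/F), χ (τ * φ) := by
  rw [frobAvg, sum_indicator_frobClass χ hφ]

theorem frobAvg_of_eq_empty (χ : Gal(N/F) → ℂ) {M : ℕ} (h : frobClass F Q M = ∅) :
    frobAvg χ Q M = 0 := by
  simp [frobAvg, h]

theorem norm_frobAvg_le {χ : Gal(N/F) → ℂ} {d : ℝ} (hd : ∀ σ, ‖χ σ‖ ≤ d) (Q : Ideal (𝓞 N))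
    (M : ℕ) : ‖frobAvg χ Q M‖ ≤ d := by
  rcases (frobClass F Q M).eq_empty_or_nonempty with h | ⟨φ, hφ⟩
  · rw [frobAvg_of_eq_empty χ h, norm_zero]
    exact (norm_nonneg _).trans (hd 1)
  · have := Fintype.ofFinite (Q.inertia Gal(N/F))
    rw [frobAvg_of_mem χ hφ, norm_mul, norm_inv, Complex.norm_natCast,
      inv_mul_le_iff₀ (by exact_mod_cast Nat.card_pos)]
    refine (norm_sum_le _ _).trans ((Finset.sum_le_card_nsmul _ _ d fun τ _ => hd _).trans ?_)
    rw [Finset.card_univ, Nat.card_eq_fintype_card, nsmul_eq_mul]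

theorem sum_frobClass_smul {M : ℕ} (g : Gal(N/F)) (Q : Ideal (𝓞 N)) (χ : Gal(N/F) → ℂ) :
    ∑ σ, (frobClass F (g • Q) M).indicator χ σ =
      ∑ σ, (frobClass F Q M).indicator (fun σ => χ (g * σ * g⁻¹)) σ := by
  classical
  refine Fintype.sum_equiv (MulAut.conj g⁻¹).toEquiv _ _ fun σ => ?_
  simp only [Set.indicator_apply, conj_mem_frobClass_iff]
  simp [mul_assoc]

theorem frobAvg_smul {χ : Gal(N/F) → ℂ} (hχ : ∀ g σ, χ (g * σ * g⁻¹) = χ σ) (g : Gal(N/F))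
    (Q : Ideal (𝓞 N)) (M : ℕ) : frobAvg χ (g • Q) M = frobAvg χ Q M := by
  simp only [frobAvg, card_inertia_smul, sum_frobClass_smul, hχ]

variable [IsGalois F N]

theorem arithFrobAt_mem_frobClass (p : Ideal (𝓞 F)) [Q.IsPrime] [Q.LiesOver p]
    [Finite (𝓞 N ⧸ Q)] :
    arithFrobAt (𝓞 F) Gal(N/F) Q ∈ frobClass F Q (Ideal.absNorm p) := by
  intro x
  have := IsArithFrobAt.arithFrobAt (𝓞 F) Gal(N/F) Q x
  rwa [← Q.over_def p] at this

/-- If some automorphism acts as `x ↦ x ^ (l ^ j)` modulo `Q`, then `l ^ j` is a power of the order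
of the residue field of the base. -/
theorem dvd_of_mem_frobClass {p : Ideal (𝓞 F)} [p.IsMaximal] [Q.LiesOver p] {l f j : ℕ}
    (hl : 1 < l) (hf : Ideal.absNorm p = l ^ f) {σ : Gal(N/F)}
    (hσ : σ ∈ frobClass F Q (l ^ j)) : f ∣ j := by
  let : Field (𝓞 F ⧸ p) := Ideal.Quotient.field p
  have hcard : Nat.card (𝓞 F ⧸ p) = l ^ f := hf
  -- `σ` is trivial on `𝓞 F`, so the power map is the identity on the residue field of `p`.
  have hpow (y : 𝓞 F ⧸ p) : y ^ l ^ j = y := by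
    obtain ⟨x, rfl⟩ := Ideal.Quotient.mk_surjective y
    rw [← map_pow, eq_comm, Ideal.Quotient.eq, Q.over_def p, Ideal.mem_comap, map_sub, map_pow]
    have := hσ (algebraMap (𝓞 F) (𝓞 N) x)
    rwa [smul_algebraMap] at this
  -- A generator of the unit group gives `l ^ f - 1 ∣ l ^ j - 1`, and the gcd of these two numbers
  -- is `l ^ gcd(f, j) - 1`.
  obtain ⟨u, hu⟩ := IsCyclic.exists_ofOrder_eq_natCard (α := (𝓞 F ⧸ p)ˣ)
  rw [Nat.card_units, hcard] at hu
  have hu1 : u ^ (l ^ j - 1) = 1 := by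
    have h1 : u ^ (l ^ j - 1) * u = u := by
      rw [← pow_succ, Nat.sub_add_cancel (Nat.one_le_pow _ _ (by omega))]
      exact Units.ext (by simpa using hpow u)
    exact mul_eq_right.mp h1
  have hdvd := orderOf_dvd_of_pow_eq_one hu1
  rw [hu] at hdvd
  have hgcd := Nat.gcd_eq_left hdvd
  rw [Nat.pow_sub_one_gcd_pow_sub_one] at hgcd
  have h1 : l ^ f.gcd j = l ^ f := by
    have h2 := Nat.one_le_pow (f.gcd j) l (by omega)
    have h3 := Nat.one_le_pow f l (by omega)
    omega
  exact Nat.gcd_eq_left_iff_dvd.mp (Nat.pow_right_injective hl h1)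

end FrobeniusClasses

/-! ### Logarithms of Euler factors. -/

section EulerFactors

variable {F N : Type*} [Field F] [NumberField F] [Field N] [NumberField N]
  [Algebra F N] [IsGalois F N]

theorem IsCharacter.conj_apply {G : Type*} [Group G] {χ : G → ℂ} (hχ : IsCharacter χ) (g σ : G) :
    χ (g * σ * g⁻¹) = χ σ := by
  rw [← hχ.rep_character, Representation.char_conj]

theorem IsCharacter.norm_apply_le {G : Type*} [Group G] [Finite G] {χ : G → ℂ}
    (hχ : IsCharacter χ) (σ : G) : ‖χ σ‖ ≤ hχ.degree := by
  conv_lhs => rw [← hχ.rep_character]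
  simpa using norm_character_le hχ.rep σ

theorem one_lt_absNorm (p : HeightOneSpectrum (𝓞 F)) : 1 < Ideal.absNorm p.asIdeal := by
  have h0 : Ideal.absNorm p.asIdeal ≠ 0 := by
    simpa [Ideal.absNorm_eq_zero_iff] using p.ne_bot
  have h1 : Ideal.absNorm p.asIdeal ≠ 1 := by
    simpa [Ideal.absNorm_eq_one_iff] using p.isPrime.ne_top
  omega

theorem norm_absNorm_cpow_lt_one (p : HeightOneSpectrum (𝓞 F)) {s : ℂ} (hs : 0 < s.re) :
    ‖(Ideal.absNorm p.asIdeal : ℂ) ^ (-s)‖ < 1 := by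
  rw [Complex.norm_natCast_cpow_of_pos (by have := one_lt_absNorm p; omega)]
  exact Real.rpow_lt_one_of_one_lt_of_neg (by exact_mod_cast one_lt_absNorm p) (by simpa using hs)

/-- The trace of a power of Frobenius on the inertia invariants. -/
theorem trace_frobOnInvariants_pow {V : Type*} [AddCommGroup V] [Module ℂ V]
    [FiniteDimensional ℂ V] (ρ : Representation ℂ Gal(N/F) V) (p : Ideal (𝓞 F))
    (Q : Ideal (𝓞 N)) [Q.IsPrime] [Q.LiesOver p] [Finite (𝓞 N ⧸ Q)] (n : ℕ) :
    LinearMap.trace ℂ _ (frobOnInvariants F ρ Q ^ n) =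
      frobAvg ρ.character Q (Ideal.absNorm p ^ n) := by
  have := Fintype.ofFinite (Q.inertia Gal(N/F))
  rw [frobAvg_of_mem _ (pow_mem_frobClass (arithFrobAt_mem_frobClass p) n), frobOnInvariants,
    Module.End.pow_restrict]
  refine (trace_restrict_invariants _ _ _).trans ?_
  congr 1
  refine Finset.sum_congr rfl fun τ _ => ?_
  rw [LinearMap.trace_mul_comm, ← map_pow]
  exact congrArg (LinearMap.trace ℂ V) (map_mul ρ _ _).symm

/-- A logarithm of the Euler factor of `χ` at `p`, as a power series in `N(p) ^ (-s)`. -/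
def eulerLog (χ : Gal(N/F) → ℂ) (p : HeightOneSpectrum (𝓞 F)) (s : ℂ) : ℂ :=
  ∑' n : ℕ, ((Ideal.absNorm p.asIdeal : ℂ) ^ (-s)) ^ n / n *
    frobAvg χ (primeAbove F N p).1 (Ideal.absNorm p.asIdeal ^ n)

/-- Frobenius has finite order on the inertia invariants, so `exists_hasSum_trace_pow` applies. The
series involves `χ` only, so the chosen representation drops out. -/
theorem hasSum_eulerLog {χ : Gal(N/F) → ℂ} (hχ : IsCharacter χ) (p : HeightOneSpectrum (𝓞 F))
    {s : ℂ} (hs : 0 < s.re) :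
    HasSum (fun n : ℕ => ((Ideal.absNorm p.asIdeal : ℂ) ^ (-s)) ^ n / n *
      frobAvg χ (primeAbove F N p).1 (Ideal.absNorm p.asIdeal ^ n)) (eulerLog χ p s) ∧
    Complex.exp (eulerLog χ p s) = eulerFactor F N χ p s := by
  have hfin : IsOfFinOrder (frobOnInvariants F hχ.rep (primeAbove F N p).1) := by
    obtain ⟨m, hm, h⟩ := isOfFinOrder_iff_pow_eq_one.mp
      (isOfFinOrder_of_finite (arithFrobAt (𝓞 F) Gal(N/F) (primeAbove F N p).1))
    refine isOfFinOrder_iff_pow_eq_one.mpr ⟨m, hm, ?_⟩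
    rw [frobOnInvariants, Module.End.pow_restrict]
    ext v
    simp [← map_pow, h]
  obtain ⟨L, hL, hexp⟩ := exists_hasSum_trace_pow hfin (norm_absNorm_cpow_lt_one p hs)
  simp_rw [trace_frobOnInvariants_pow hχ.rep p.asIdeal, hχ.rep_character] at hL
  have hLeq : eulerLog χ p s = L := hL.tsum_eq
  rw [hLeq]
  refine ⟨hL, ?_⟩
  rw [hexp, eulerFactor, dif_pos hχ, repEulerFactor]

/-- With `t = N(p)^(-Re s)`, comparison with a geometric series gives `d * t / (1 - t)`; the uniform
factor `2` comes from `N(p) ≥ 2`, hence `t ≤ 1/2`. -/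
theorem norm_eulerLog_le {χ : Gal(N/F) → ℂ} (hχ : IsCharacter χ) (p : HeightOneSpectrum (𝓞 F))
    {s : ℂ} (hs : 1 < s.re) :
    ‖eulerLog χ p s‖ ≤ 2 * hχ.degree * (Ideal.absNorm p.asIdeal : ℝ) ^ (-s.re) := by
  have hq : (2 : ℝ) ≤ Ideal.absNorm p.asIdeal := by exact_mod_cast one_lt_absNorm p
  set t : ℝ := (Ideal.absNorm p.asIdeal : ℝ) ^ (-s.re) with ht
  have hnorm : ‖(Ideal.absNorm p.asIdeal : ℂ) ^ (-s)‖ = t := by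
    rw [Complex.norm_natCast_cpow_of_pos (by have := one_lt_absNorm p; omega), Complex.neg_re]
  have ht0 : 0 ≤ t := by positivity
  have ht2 : t ≤ 1 / 2 := by
    calc t ≤ (Ideal.absNorm p.asIdeal : ℝ) ^ (-1 : ℝ) :=
          Real.rpow_le_rpow_of_exponent_le (by linarith) (by linarith)
      _ = (Ideal.absNorm p.asIdeal : ℝ)⁻¹ := Real.rpow_neg_one _
      _ ≤ 1 / 2 := by rw [one_div]; exact inv_anti₀ (by norm_num) hq
  have hgeo : HasSum (fun n : ℕ => hχ.degree * t * t ^ n) (hχ.degree * t * (1 - t)⁻¹) :=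
    (hasSum_geometric_of_lt_one ht0 (by linarith)).mul_left _
  have hbound : ‖eulerLog χ p s‖ ≤ hχ.degree * t * (1 - t)⁻¹ := by
    have h := (hasSum_eulerLog hχ p (by linarith : 0 < s.re)).1
    rw [← hasSum_nat_add_iff' 1] at h
    simp only [Finset.range_one, Finset.sum_singleton, Nat.cast_zero, div_zero, zero_mul,
      sub_zero] at h
    refine h.norm_le_of_bounded hgeo fun n => ?_
    rw [norm_mul, norm_div, norm_pow, hnorm, Complex.norm_natCast]
    have h1 : t ^ (n + 1) / ((n + 1 : ℕ) : ℝ) ≤ t ^ (n + 1) :=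
      div_le_self (by positivity) (by exact_mod_cast Nat.succ_pos n)
    calc _ ≤ t ^ (n + 1) * hχ.degree :=
          mul_le_mul h1 (norm_frobAvg_le hχ.norm_apply_le _ _) (norm_nonneg _) (by positivity)
      _ = _ := by ring
  refine hbound.trans ?_
  have h2 : (1 - t)⁻¹ ≤ 2 := by
    rw [inv_le_comm₀ (by linarith) (by norm_num)]
    linarith
  calc _ ≤ hχ.degree * t * 2 := by gcongr
    _ = _ := by ring

end EulerFactors

/-! ### Invariance of Frobenius averages under inflation. -/

theorem card_mul_sum_comp {A B : Type*} [Group A] [Group B] [Fintype A] [Fintype B]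
    {f : A →* B} (hf : Function.Surjective f) (F : B → ℂ) :
    (Nat.card B : ℂ) * ∑ a, F (f a) = Nat.card A * ∑ b, F b := by
  have h1 (b : B) : ∑ a, F (f a * b) = ∑ a, F (f a) := by
    obtain ⟨a', rfl⟩ := hf b
    exact Fintype.sum_equiv (Equiv.mulRight a') _ _ fun a => by simp
  have h2 (b : B) : ∑ x, F (b * x) = ∑ x, F x :=
    Fintype.sum_equiv (Equiv.mulLeft b) _ _ fun _ => rfl
  calc (Nat.card B : ℂ) * ∑ a, F (f a) = ∑ b, ∑ a, F (f a * b) := by simp [h1]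
    _ = ∑ a, ∑ b, F (f a * b) := Finset.sum_comm
    _ = Nat.card A * ∑ b, F b := by simp [h2]

section Inflation

variable {k K K' : Type*} [Field k] [Field K] [Field K'] [Algebra k K] [Algebra k K']
  [Algebra K K'] [IsScalarTower k K K'] [IsGalois k K]

theorem algebraMap_restrictNormalHom_smul (σ : Gal(K'/k)) (x : 𝓞 K) :
    algebraMap (𝓞 K) (𝓞 K') (AlgEquiv.restrictNormalHom K σ • x) =
      σ • algebraMap (𝓞 K) (𝓞 K') x := by
  refine RingOfIntegers.ext ?_
  exact AlgEquiv.restrictNormal_commutes σ K x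

variable {Q : Ideal (𝓞 K)} {Q' : Ideal (𝓞 K')} [Q'.LiesOver Q]

variable (Q) in
theorem restrictNormalHom_mem_frobClass {M : ℕ} {σ : Gal(K'/k)} (hσ : σ ∈ frobClass k Q' M) :
    AlgEquiv.restrictNormalHom K σ ∈ frobClass k Q M := by
  intro x
  rw [Q'.over_def Q, Ideal.mem_comap, map_sub, map_pow, algebraMap_restrictNormalHom_smul]
  exact hσ _

variable [NumberField K] [NumberField K']

variable (Q Q') in
/-- Restriction of automorphisms, between inertia groups. -/
def inertiaRestrict : Q'.inertia Gal(K'/k) →* Q.inertia Gal(K/k) :=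
  ((AlgEquiv.restrictNormalHom K).comp (Q'.inertia Gal(K'/k)).subtype).codRestrict _ fun σ =>
    mem_frobClass_one.mp (restrictNormalHom_mem_frobClass Q (mem_frobClass_one.mpr σ.2))

/-- An element of the kernel fixes `K`, so it lies in the inertia group of `K'/K`. -/
theorem card_ker_inertiaRestrict_le :
    Nat.card (inertiaRestrict (k := k) Q Q').ker ≤ Nat.card (Q'.inertia Gal(K'/K)) := by
  have hcomm (σ : (inertiaRestrict (k := k) Q Q').ker) (x : K) :
      σ.1.1 (algebraMap K K' x) = algebraMap K K' x := by
    have h1 : AlgEquiv.restrictNormalHom K σ.1.1 = 1 :=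
      congrArg Subtype.val (MonoidHom.mem_ker.mp σ.2)
    have h2 := AlgEquiv.restrictNormal_commutes σ.1.1 K x
    rw [← h2]
    exact congrArg (fun τ : Gal(K/k) => algebraMap K K' (τ x)) h1
  refine Nat.card_le_card_of_injective
    (fun σ => ⟨AlgEquiv.ofRingEquiv (f := σ.1.1.toRingEquiv) (hcomm σ), fun x => σ.1.2 x⟩) ?_
  intro σ τ h
  refine Subtype.ext (Subtype.ext (AlgEquiv.ext fun x => ?_))
  exact congrArg (fun ρ : Q'.inertia Gal(K'/K) => ρ.1 x) h

theorem card_inertia_eq_ramificationIdx {F N : Type*} [Field F] [NumberField F] [Field N]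
    [NumberField N] [Algebra F N] [IsGalois F N] (p : Ideal (𝓞 F)) [p.IsMaximal] (Q : Ideal (𝓞 N))
    [Q.IsPrime] [Q.LiesOver p] :
    Nat.card (Q.inertia Gal(N/F)) = Q.ramificationIdx (𝓞 F) := by
  rw [Ideal.card_inertia_eq_ramificationIdxIn (G := Gal(N/F)) p Q,
    Ideal.ramificationIdxIn_eq_ramificationIdx p Q Gal(N/F)]

variable [NumberField k] [IsGalois k K'] [IsGalois K K']

/-- Orders of inertia groups are ramification indices, which multiply in towers. The bound on the
kernel then leaves an image at least as large as the target. -/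
theorem inertiaRestrict_surjective (p : Ideal (𝓞 k)) [p.IsMaximal] [Q.IsMaximal] [Q'.IsPrime]
    [Q.LiesOver p] : Function.Surjective (inertiaRestrict (k := k) Q Q') := by
  have : Q'.LiesOver p := Ideal.LiesOver.trans Q' Q p
  have h1 : Nat.card (Q'.inertia Gal(K'/k)) =
      Nat.card (Q.inertia Gal(K/k)) * Nat.card (Q'.inertia Gal(K'/K)) := by
    rw [card_inertia_eq_ramificationIdx p, card_inertia_eq_ramificationIdx p,
      card_inertia_eq_ramificationIdx Q, ← Ideal.ramificationIdx_tower Q Q']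
  have h2 := (inertiaRestrict (k := k) Q Q').ker.card_eq_card_quotient_mul_card_subgroup
  rw [Nat.card_congr (QuotientGroup.quotientKerEquivRange _).toEquiv, h1] at h2
  have h3 : Nat.card (Q.inertia Gal(K/k)) ≤ Nat.card (inertiaRestrict (k := k) Q Q').range := by
    have h4 : 0 < Nat.card (Q'.inertia Gal(K'/K)) := Nat.card_pos
    refine Nat.le_of_mul_le_mul_right ?_ h4
    rw [h2]
    exact Nat.mul_le_mul_left _ card_ker_inertiaRestrict_le
  rw [← MonoidHom.range_eq_top]
  exact Subgroup.eq_top_of_le_card _ h3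

/-- Averages over Frobenius classes are invariant under inflation. -/
theorem frobAvg_inflation (χ : Gal(K/k) → ℂ) {p : Ideal (𝓞 k)} [p.IsMaximal] [Q.IsMaximal]
    [Q'.IsMaximal] [Q.LiesOver p] {l f : ℕ} (hl : 1 < l) (hf : Ideal.absNorm p = l ^ f) (j : ℕ) :
    frobAvg (inflation K' χ) Q' (l ^ j) = frobAvg χ Q (l ^ j) := by
  have : Q'.LiesOver p := Ideal.LiesOver.trans Q' Q p
  rcases (frobClass k Q (l ^ j)).eq_empty_or_nonempty with h | ⟨σ, hσ⟩
  · rw [frobAvg_of_eq_empty χ h, frobAvg_of_eq_empty]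
    exact Set.eq_empty_of_forall_notMem fun σ hσ => by
      simpa [h] using restrictNormalHom_mem_frobClass Q hσ
  -- A nonempty class below forces `f ∣ j`, so a power of Frobenius of `K'/k` lies in the class
  -- above, and its restriction represents the class below.
  · obtain ⟨n, rfl⟩ := dvd_of_mem_frobClass (p := p) hl hf hσ
    rw [pow_mul, ← hf]
    have hφ' := pow_mem_frobClass (arithFrobAt_mem_frobClass (Q := Q') p) n
    have hφ := restrictNormalHom_mem_frobClass Q hφ'
    have := Fintype.ofFinite (Q.inertia Gal(K/k))
    have := Fintype.ofFinite (Q'.inertia Gal(K'/k))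
    rw [frobAvg_of_mem _ hφ, frobAvg_of_mem _ hφ',
      inv_mul_eq_iff_eq_mul₀ card_inertia_ne_zero, ← mul_assoc, mul_comm (Nat.card _ : ℂ),
      mul_assoc, eq_inv_mul_iff_mul_eq₀ card_inertia_ne_zero,
      ← card_mul_sum_comp (inertiaRestrict_surjective (Q := Q) (Q' := Q') p)]
    congr 1
    refine Finset.sum_congr rfl fun τ _ => ?_
    rw [inflation, map_mul]
    rfl

end Inflation

/-! ### Frobenius averages of induced characters. -/

theorem card_mul_sum_smul {G X : Type*} [Group G] [Fintype G] [MulAction G X] [Fintype X]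
    [MulAction.IsPretransitive G X] (h : X → ℂ) (x₀ : X) :
    (Nat.card X : ℂ) * ∑ g : G, h (g • x₀) = Nat.card G * ∑ x, h x := by
  have h1 (x : X) : ∑ g : G, h (g • x) = ∑ g : G, h (g • x₀) := by
    obtain ⟨a, rfl⟩ := MulAction.exists_smul_eq G x₀ x
    exact Fintype.sum_equiv (Equiv.mulRight a) _ _ fun g => by simp [mul_smul]
  have h2 (g : G) : ∑ x, h (g • x) = ∑ x, h x :=
    Fintype.sum_equiv (MulAction.toPerm g) _ _ fun _ => rfl
  calc (Nat.card X : ℂ) * ∑ g : G, h (g • x₀) = ∑ x, ∑ g : G, h (g • x) := by simp [h1]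
    _ = ∑ g : G, ∑ x, h (g • x) := Finset.sum_comm
    _ = Nat.card G * ∑ x, h x := by simp [h2]

open scoped Pointwise in
theorem card_mul_sum_smul_primesOver {A B G : Type*} [CommRing A] [CommRing B] [Algebra A B]
    [Group G] [Fintype G] [MulSemiringAction G B] [IsGaloisGroup G A B] (p : Ideal A)
    [Fintype (p.primesOver B)] (h : Ideal B → ℂ) (P₀ : p.primesOver B) :
    (Nat.card (p.primesOver B) : ℂ) * ∑ g : G, h (g • P₀.1) =
      Nat.card G * ∑ Q : p.primesOver B, h Q.1 :=
  card_mul_sum_smul (fun Q : p.primesOver B => h Q.1) P₀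

/-- The primes above `p` in a tower, grouped by the intermediate prime. -/
def sigmaPrimesOverEquiv {A B C : Type*} [CommRing A] [CommRing B] [CommRing C] [Algebra A B]
    [Algebra B C] [Algebra A C] [IsScalarTower A B C] (p : Ideal A) :
    (Σ q : p.primesOver B, q.1.primesOver C) ≃ p.primesOver C :=
  Equiv.ofBijective
    (fun x => ⟨x.2.1, x.2.2.1, have := x.2.2.2; have := x.1.2.2; .trans x.2.1 x.1.1 p⟩) <| by
    constructor
    · rintro ⟨⟨q₁, _, _⟩, ⟨P₁, _, h₁⟩⟩ ⟨⟨q₂, _, _⟩, ⟨P₂, _, h₂⟩⟩ h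
      obtain rfl : P₁ = P₂ := congrArg Subtype.val h
      obtain rfl : q₁ = q₂ := h₁.over.trans h₂.over.symm
      rfl
    · rintro ⟨P, hP, hPp⟩
      exact ⟨⟨⟨P.under B, inferInstance, ⟨by rw [Ideal.under_under, hPp.over]⟩⟩, ⟨P, hP, ⟨rfl⟩⟩⟩, rfl⟩

theorem sigmaPrimesOverEquiv_apply_coe {A B C : Type*} [CommRing A] [CommRing B] [CommRing C]
    [Algebra A B] [Algebra B C] [Algebra A C] [IsScalarTower A B C] (p : Ideal A)
    (x : Σ q : p.primesOver B, q.1.primesOver C) : (sigmaPrimesOverEquiv p x).1 = x.2.1 := rfl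

section Induction

open scoped Pointwise

variable {k K K' : Type*} [Field k] [NumberField k] [Field K] [NumberField K] [Field K']
  [NumberField K'] [Algebra k K] [Algebra k K'] [Algebra K K'] [IsScalarTower k K K']
  [IsGalois k K]

theorem restrictScalarsHom_injective :
    Function.Injective (AlgEquiv.restrictScalarsHom ℚ : Gal(K'/k) →* Gal(K'/ℚ)) :=
  AlgEquiv.restrictScalars_injective ℚ

/-- The congruence defining a class ignores the base field, so the class over `k` is the part of the
class over `ℚ` lying in `Gal(K'/k)`. -/
theorem sum_frobClass_extend (ψ : Gal(K'/k) → ℂ) (P : Ideal (𝓞 K')) (M : ℕ) :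
    ∑ σ : Gal(K'/ℚ), (frobClass ℚ P M).indicator
        (Function.extend (AlgEquiv.restrictScalarsHom ℚ : Gal(K'/k) →* Gal(K'/ℚ)) ψ 0) σ =
      Nat.card (P.inertia Gal(K'/k)) * frobAvg ψ P M := by
  classical
  rw [frobAvg, mul_inv_cancel_left₀ card_inertia_ne_zero]
  simp only [Set.indicator_apply, extend_eq_sum restrictScalarsHom_injective]
  have h1 (σ : Gal(K'/ℚ)) : (if σ ∈ frobClass ℚ P M then
      ∑ u : Gal(K'/k), if AlgEquiv.restrictScalarsHom ℚ u = σ then ψ u else 0 else 0) =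
      ∑ u : Gal(K'/k), if AlgEquiv.restrictScalarsHom ℚ u = σ then
        (if u ∈ frobClass k P M then ψ u else 0) else 0 := by
    split_ifs with hσ
    · refine Finset.sum_congr rfl fun u _ => ?_
      split_ifs with hu hu'
      · rfl
      · subst hu
        exact absurd hσ hu'
      · rfl
    · refine (Finset.sum_eq_zero fun u _ => ?_).symm
      split_ifs with hu hu'
      · subst hu
        exact absurd hu' hσ
      · rfl
      · rfl
  simp_rw [h1]
  rw [Finset.sum_comm]
  refine Finset.sum_congr rfl fun u _ => ?_
  rw [Finset.sum_eq_single (AlgEquiv.restrictScalarsHom ℚ u) (fun σ _ h => if_neg h.symm) (by simp),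
    if_pos rfl]

theorem card_eq_mul (F N : Type*) [Field F] [NumberField F] [Field N] [NumberField N] [Algebra F N]
    [IsGalois F N] (p : Ideal (𝓞 F)) [p.IsMaximal] (Q : Ideal (𝓞 N)) [Q.IsPrime] [Q.LiesOver p] :
    Nat.card Gal(N/F) = Nat.card (p.primesOver (𝓞 N)) *
      Nat.card (Q.inertia Gal(N/F)) * Q.inertiaDeg (𝓞 F) := by
  rw [← Ideal.ncard_primesOver_mul_card_inertia_mul_finrank (G := Gal(N/F)) p Q]
  rfl

variable [IsGalois ℚ K']

/-- Conjugating by `x` moves the class at `P₀` to the class at `x • P₀`. Each prime above `P` arises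
from `e * f` elements `x`, and the factor `e` cancels against the order of the inertia group. -/
theorem frobAvg_inducedCharacter (ψ : Gal(K'/k) → ℂ) (P : Ideal (𝓞 ℚ)) [P.IsMaximal]
    (P₀ : P.primesOver (𝓞 K')) (M : ℕ) [Fintype (P.primesOver (𝓞 K'))] :
    frobAvg (inducedCharacter (AlgEquiv.restrictScalarsHom ℚ : Gal(K'/k) →* Gal(K'/ℚ)) ψ) P₀.1 M =
      (Nat.card Gal(K'/k) : ℂ)⁻¹ * ∑ Q : P.primesOver (𝓞 K'),
        Q.1.inertiaDeg (𝓞 ℚ) * (Nat.card (Q.1.inertia Gal(K'/k)) * frobAvg ψ Q.1 M) := by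
  have hdeg (Q : P.primesOver (𝓞 K')) : Q.1.inertiaDeg (𝓞 ℚ) = P₀.1.inertiaDeg (𝓞 ℚ) :=
    Ideal.inertiaDeg_eq_of_isGaloisGroup P Q.1 P₀.1 Gal(K'/ℚ)
  have hX : (Nat.card (P.primesOver (𝓞 K')) : ℂ) ≠ 0 := by
    have : Nonempty (P.primesOver (𝓞 K')) := ⟨P₀⟩
    exact Nat.cast_ne_zero.mpr Nat.card_pos.ne'
  have hsum : ∑ σ, (frobClass ℚ P₀.1 M).indicator
      (inducedCharacter (AlgEquiv.restrictScalarsHom ℚ : Gal(K'/k) →* Gal(K'/ℚ)) ψ) σ =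
      (Nat.card Gal(K'/k) : ℂ)⁻¹ * ∑ x : Gal(K'/ℚ),
        (Nat.card ((x • P₀.1).inertia Gal(K'/k)) * frobAvg ψ (x • P₀.1) M) := by
    simp_rw [← sum_frobClass_extend, sum_frobClass_smul]
    rw [Finset.sum_comm, Finset.mul_sum]
    refine Finset.sum_congr rfl fun σ _ => ?_
    classical
    simp only [Set.indicator_apply, inducedCharacter]
    split_ifs
    · congr 1
      exact Fintype.sum_equiv (Equiv.inv _) _ _ fun x => by simp
    · simp
  have hsmul := card_mul_sum_smul_primesOver (G := Gal(K'/ℚ)) P (fun Q =>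
    (Nat.card (Q.inertia Gal(K'/k)) * frobAvg ψ Q M : ℂ)) P₀
  rw [card_eq_mul ℚ K' P P₀.1] at hsmul
  push_cast at hsmul
  rw [mul_assoc, mul_assoc] at hsmul
  rw [frobAvg, hsum, mul_left_cancel₀ hX hsmul]
  simp_rw [hdeg, ← Finset.mul_sum]
  have hI : (Nat.card (P₀.1.inertia Gal(K'/ℚ)) : ℂ) ≠ 0 := card_inertia_ne_zero
  field_simp

variable [IsGalois k K'] [IsGalois K K']

/-- Averages over Frobenius classes of an inflated and induced character. -/
theorem frobAvg_inducedInflation {χ : Gal(K/k) → ℂ} (hχ : ∀ g σ, χ (g * σ * g⁻¹) = χ σ)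
    (P : Ideal (𝓞 ℚ)) [P.IsMaximal] [Fintype (P.primesOver (𝓞 k))]
    (hP : 1 < Ideal.absNorm P) (P₀ : P.primesOver (𝓞 K'))
    (Q : ∀ p : P.primesOver (𝓞 k), p.1.primesOver (𝓞 K)) (j : ℕ) :
    frobAvg (inducedInflation K' χ) P₀.1 (Ideal.absNorm P ^ j) =
      ∑ p : P.primesOver (𝓞 k), p.1.inertiaDeg (𝓞 ℚ) *
        frobAvg χ (Q p).1 (Ideal.absNorm P ^ j) := by
  have (p : P.primesOver (𝓞 k)) : Finite (p.1.primesOver (𝓞 K')) :=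
    Algebra.QuasiFinite.finite_primesOver p.1
  have (p : P.primesOver (𝓞 k)) := Fintype.ofFinite (p.1.primesOver (𝓞 K'))
  have := Fintype.ofEquiv _ (sigmaPrimesOverEquiv (B := 𝓞 k) (C := 𝓞 K') P)
  rw [inducedInflation, frobAvg_inducedCharacter,
    ← Equiv.sum_comp (sigmaPrimesOverEquiv (B := 𝓞 k) P), Fintype.sum_sigma, Finset.mul_sum]
  refine Finset.sum_congr rfl fun p _ => ?_
  -- All `R` above `p` contribute equally: `|Gal(K'/k)| = r * e * f` with `r` primes above `p`,
  -- inertia degrees multiply, and the prime of `K` below `R` is conjugate to `Q p`.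
  have hterm (R : p.1.primesOver (𝓞 K')) : (R.1.inertiaDeg (𝓞 ℚ) : ℂ) *
      (Nat.card (R.1.inertia Gal(K'/k)) *
        frobAvg (inflation K' χ) R.1 (Ideal.absNorm P ^ j)) =
      (Nat.card Gal(K'/k) : ℂ) * (Nat.card (p.1.primesOver (𝓞 K')) : ℂ)⁻¹ *
        (p.1.inertiaDeg (𝓞 ℚ) * frobAvg χ (Q p).1 (Ideal.absNorm P ^ j)) := by
    have hX : (Nat.card (p.1.primesOver (𝓞 K')) : ℂ) ≠ 0 := by
      have : Nonempty (p.1.primesOver (𝓞 K')) := ⟨R⟩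
      exact Nat.cast_ne_zero.mpr Nat.card_pos.ne'
    have : (R.1.under (𝓞 K)).LiesOver p.1 := ⟨by rw [Ideal.under_under, ← R.1.over_def p.1]⟩
    obtain ⟨g, hg⟩ := Ideal.exists_smul_eq_of_isGaloisGroup p.1 (Q p).1 (R.1.under (𝓞 K)) Gal(K/k)
    rw [frobAvg_inflation (Q := R.1.under (𝓞 K)) χ (p := p.1) hP
      (Ideal.absNorm_pow_inertiaDeg P p.1).symm, ← hg, frobAvg_smul hχ, card_eq_mul k K' p.1 R.1,
      Ideal.inertiaDeg_tower p.1 R.1]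
    push_cast
    field_simp
  simp_rw [sigmaPrimesOverEquiv_apply_coe, hterm]
  have hX : (Nat.card (p.1.primesOver (𝓞 K')) : ℂ) ≠ 0 :=
    Nat.cast_ne_zero.mpr Nat.card_pos.ne'
  have hU : (Nat.card Gal(K'/k) : ℂ) ≠ 0 := Nat.cast_ne_zero.mpr Nat.card_pos.ne'
  rw [Finset.sum_const, Finset.card_univ, ← Nat.card_eq_fintype_card, nsmul_eq_mul]
  field_simp

end Induction

/-! ### Grouping the primes of `k` over `ℚ`; summability. -/

section Primes

variable (k : Type*) [Field k] [NumberField k]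

/-- The prime of `k` given by a prime ideal above a rational prime. -/
def primeOfPrimesOver (P : HeightOneSpectrum (𝓞 ℚ)) (p : P.asIdeal.primesOver (𝓞 k)) :
    HeightOneSpectrum (𝓞 k) :=
  ⟨p.1, p.2.1, have := p.2.2; Ideal.ne_bot_of_liesOver_of_ne_bot P.ne_bot p.1⟩

/-- The primes of `k`, grouped by the rational prime below. -/
def sigmaPrimesEquiv :
    (Σ P : HeightOneSpectrum (𝓞 ℚ), P.asIdeal.primesOver (𝓞 k)) ≃ HeightOneSpectrum (𝓞 k) :=
  Equiv.ofBijective (fun x => primeOfPrimesOver k x.1 x.2) <| by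
    constructor
    · rintro ⟨⟨P₁, _, _⟩, ⟨p₁, _, h₁⟩⟩ ⟨⟨P₂, _, _⟩, ⟨p₂, _, h₂⟩⟩ h
      obtain rfl : p₁ = p₂ := congrArg HeightOneSpectrum.asIdeal h
      obtain rfl : P₁ = P₂ := h₁.over.trans h₂.over.symm
      rfl
    · intro p
      exact ⟨⟨p.under (𝓞 ℚ), ⟨p.asIdeal, p.isPrime, ⟨rfl⟩⟩⟩, rfl⟩

variable {k}

/-- A prime of `𝓞 ℚ` is generated by its norm. -/
theorem absNorm_injective :
    Function.Injective fun P : HeightOneSpectrum (𝓞 ℚ) => Ideal.absNorm P.asIdeal := by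
  have h (P : HeightOneSpectrum (𝓞 ℚ)) :
      P.asIdeal = Ideal.span {(Ideal.absNorm P.asIdeal : 𝓞 ℚ)} := by
    set n := Rat.HeightOneSpectrum.natGenerator P
    set e := Rat.IsIntegralClosure.intEquiv (𝓞 ℚ)
    have h1 : P.asIdeal = Ideal.span {(n : 𝓞 ℚ)} := by
      have h0 : Ideal.map (e : 𝓞 ℚ →+* ℤ) P.asIdeal = Ideal.span {(n : ℤ)} :=
        (Rat.HeightOneSpectrum.span_natGenerator P).symm
      rw [← Ideal.map_of_equiv (I := P.asIdeal) e, h0, Ideal.map_span]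
      simp
    have h2 := congrArg Ideal.absNorm h1
    rw [Ideal.absNorm_span_natCast, RingOfIntegers.rank, Module.finrank_self, pow_one] at h2
    rw [h2, h1]
  intro P₁ P₂ h12
  refine HeightOneSpectrum.ext ?_
  rw [h P₁, h P₂]
  exact congrArg (fun n : ℕ => Ideal.span {(n : 𝓞 ℚ)}) h12

instance (P : HeightOneSpectrum (𝓞 ℚ)) : Finite (P.asIdeal.primesOver (𝓞 k)) :=
  Algebra.QuasiFinite.finite_primesOver P.asIdeal

theorem card_primesOver_le (P : HeightOneSpectrum (𝓞 ℚ)) :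
    Nat.card (P.asIdeal.primesOver (𝓞 k)) ≤ Module.finrank (𝓞 ℚ) (𝓞 k) := by
  have := Fintype.ofFinite (P.asIdeal.primesOver (𝓞 k))
  rw [← Ideal.sum_ramification_inertia_eq_finrank P.asIdeal (𝓞 k), Nat.card_eq_fintype_card,
    ← Finset.card_univ, Finset.card_eq_sum_ones]
  exact Finset.sum_le_sum fun p _ =>
    Nat.mul_pos (p.1.ramificationIdx_pos (𝓞 ℚ)) (p.1.inertiaDeg_pos (𝓞 ℚ))

/-- At most `[k : ℚ]` primes lie above `P`, each of norm at least that of `P`; this reduces the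
claim to `∑ n ^ (-σ)`. -/
theorem summable_absNorm_rpow {σ : ℝ} (hσ : 1 < σ) :
    Summable fun p : HeightOneSpectrum (𝓞 k) => (Ideal.absNorm p.asIdeal : ℝ) ^ (-σ) := by
  rw [← (sigmaPrimesEquiv k).summable_iff, summable_sigma_of_nonneg fun _ => by
    simp only [Function.comp_apply]; positivity]
  refine ⟨fun P => Summable.of_finite, ?_⟩
  have hQ : Summable fun P : HeightOneSpectrum (𝓞 ℚ) =>
      (Module.finrank (𝓞 ℚ) (𝓞 k) : ℝ) * (Ideal.absNorm P.asIdeal : ℝ) ^ (-σ) :=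
    ((Real.summable_nat_rpow.mpr (by linarith)).comp_injective absNorm_injective).mul_left _
  refine hQ.of_nonneg_of_le (fun P => tsum_nonneg fun _ => by
    simp only [Function.comp_apply]; positivity) fun P => ?_
  have := Fintype.ofFinite (P.asIdeal.primesOver (𝓞 k))
  rw [tsum_fintype]
  have hle (p : P.asIdeal.primesOver (𝓞 k)) :
      (Ideal.absNorm p.1 : ℝ) ^ (-σ) ≤ (Ideal.absNorm P.asIdeal : ℝ) ^ (-σ) := by
    refine Real.rpow_le_rpow_of_nonpos (by exact_mod_cast (one_lt_absNorm P).pos) ?_ (by linarith)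
    rw [← Ideal.absNorm_pow_inertiaDeg P.asIdeal p.1]
    exact_mod_cast Nat.le_self_pow (p.1.inertiaDeg_pos (𝓞 ℚ)).ne' _
  refine (Finset.sum_le_card_nsmul _ _ _ fun p _ => hle p).trans ?_
  rw [Finset.card_univ, ← Nat.card_eq_fintype_card, nsmul_eq_mul]
  gcongr
  exact card_primesOver_le P

end Primes

/-! ### Comparison of the Euler products. -/

section Products

variable {k K K' : Type*} [Field k] [NumberField k] [Field K] [NumberField K] [Field K']
  [NumberField K'] [Algebra k K] [Algebra k K'] [Algebra K K'] [IsScalarTower k K K']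
  [IsGalois k K] {χ : Gal(K/k) → ℂ}

/-- Substitute `N(p) = N(P) ^ f` and `j = f * n`. The factor `f` comes from `1 / n = f / j`, and
indices not divisible by `f` have empty classes. -/
theorem hasSum_eulerLog_rat (hχ : IsCharacter χ) (P : HeightOneSpectrum (𝓞 ℚ))
    (p : P.asIdeal.primesOver (𝓞 k)) {s : ℂ} (hs : 0 < s.re) :
    HasSum (fun j : ℕ => ((Ideal.absNorm P.asIdeal : ℂ) ^ (-s)) ^ j / j *
      (p.1.inertiaDeg (𝓞 ℚ) * frobAvg χ (primeAbove k K (primeOfPrimesOver k P p)).1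
        (Ideal.absNorm P.asIdeal ^ j))) (eulerLog χ (primeOfPrimesOver k P p) s) := by
  have hf := (p.1.inertiaDeg_pos (𝓞 ℚ)).ne'
  have hnorm := Ideal.absNorm_pow_inertiaDeg P.asIdeal p.1
  rw [← Function.Injective.hasSum_iff (mul_right_injective₀ hf)]
  · convert! (hasSum_eulerLog hχ (primeOfPrimesOver k P p) hs).1 using 2 with n
    have hn : Ideal.absNorm (primeOfPrimesOver k P p).asIdeal =
      Ideal.absNorm P.asIdeal ^ p.1.inertiaDeg (𝓞 ℚ) := hnorm.symm
    have hcpow : ((Ideal.absNorm (primeOfPrimesOver k P p).asIdeal : ℕ) : ℂ) ^ (-s) =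
        ((Ideal.absNorm P.asIdeal : ℂ) ^ (-s)) ^ p.1.inertiaDeg (𝓞 ℚ) := by
      rw [hn, Nat.cast_pow, ← Complex.natCast_cpow_natCast_mul, Complex.cpow_nat_mul]
    rw [Function.comp_apply, hcpow, hn, ← pow_mul, ← pow_mul]
    have hf' : (p.1.inertiaDeg (𝓞 ℚ) : ℂ) ≠ 0 := Nat.cast_ne_zero.mpr hf
    rcases eq_or_ne n 0 with rfl | hn0
    · simp
    · push_cast
      field_simp
  · intro j hj
    rw [frobAvg_of_eq_empty, mul_zero, mul_zero]
    refine Set.eq_empty_of_forall_notMem fun σ hσ => hj ?_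
    have : (primeAbove k K (primeOfPrimesOver k P p)).1.LiesOver p.1 :=
      (primeAbove k K (primeOfPrimesOver k P p)).2.2
    obtain ⟨n, rfl⟩ := dvd_of_mem_frobClass (p := p.1) (one_lt_absNorm P) hnorm.symm hσ
    exact ⟨n, rfl⟩

variable [IsGalois ℚ K'] [IsGalois k K'] [IsGalois K K']

theorem eulerLog_inducedInflation (hχ : IsCharacter χ)
    (hψ : IsCharacter (inducedInflation K' χ)) (P : HeightOneSpectrum (𝓞 ℚ))
    [Fintype (P.asIdeal.primesOver (𝓞 k))] {s : ℂ} (hs : 0 < s.re) :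
    eulerLog (inducedInflation K' χ) P s =
      ∑ p : P.asIdeal.primesOver (𝓞 k), eulerLog χ (primeOfPrimesOver k P p) s := by
  refine (hasSum_eulerLog hψ P hs).1.unique ?_
  convert! hasSum_sum fun p (_ : p ∈ Finset.univ) => hasSum_eulerLog_rat hχ P p hs using 2 with j
  rw [frobAvg_inducedInflation hχ.conj_apply P.asIdeal (one_lt_absNorm P) (primeAbove ℚ K' P)
    (fun p => primeAbove k K (primeOfPrimesOver k P p)), Finset.mul_sum]

/-- Both Euler products converge, and to the same value. -/
theorem exists_hasProd_eulerFactor (hχ : IsCharacter χ)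
    (hψ : IsCharacter (inducedInflation K' χ)) {s : ℂ} (hs : 1 < s.re) :
    ∃ a : ℂ, HasProd (fun p => eulerFactor k K χ p s) a ∧
      HasProd (fun P => eulerFactor ℚ K' (inducedInflation K' χ) P s) a := by
  have hs0 : 0 < s.re := by linarith
  have hsummable : Summable fun p : HeightOneSpectrum (𝓞 k) => eulerLog χ p s :=
    Summable.of_norm_bounded ((summable_absNorm_rpow hs).mul_left _)
      fun p => norm_eulerLog_le hχ p hs
  obtain ⟨L, hL⟩ := hsummable
  have hL' : HasSum (fun P => eulerLog (inducedInflation K' χ) P s) L := by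
    refine ((sigmaPrimesEquiv k).hasSum_iff.mpr hL).sigma fun P => ?_
    have := Fintype.ofFinite (P.asIdeal.primesOver (𝓞 k))
    rw [eulerLog_inducedInflation hχ hψ P hs0]
    exact hasSum_fintype _
  refine ⟨Complex.exp L, ?_, ?_⟩
  · simpa only [Function.comp_def, (hasSum_eulerLog hχ _ hs0).2] using hL.cexp
  · simpa only [Function.comp_def, (hasSum_eulerLog hψ _ hs0).2] using hL'.cexp

end Products

/-! ### From Euler products to L-functions. -/

section LFunctions

variable {k K : Type*} [Field k] [NumberField k] [Field K] [NumberField K] [Algebra k K]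
  [IsGalois k K]

theorem artinLFunction_eq_eulerProduct (χ : Gal(K/k) → ℂ) {s : ℂ} (hs : 1 < s.re) :
    artinLFunction k K χ s = eulerProduct k K χ s := by
  rw [artinLFunction]
  split_ifs with h
  · exact h.choose_spec.2 s hs
  · exact if_pos hs

/-- The Artin L-function is determined by the Euler product on `1 < re s`. -/
theorem artinLFunction_congr {k' K' : Type*} [Field k'] [NumberField k'] [Field K']
    [NumberField K'] [Algebra k' K'] [IsGalois k' K'] {χ : Gal(K/k) → ℂ} {χ' : Gal(K'/k') → ℂ}
    (h : ∀ s : ℂ, 1 < s.re → eulerProduct k K χ s = eulerProduct k' K' χ' s) :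
    artinLFunction k K χ = artinLFunction k' K' χ' := by
  -- The two predicates coincide, so the chosen functions do too; neither existence nor uniqueness
  -- of a continuation is needed.
  have hcont : IsContinuation k K χ = IsContinuation k' K' χ' := by
    ext f
    refine and_congr_right fun _ => forall₂_congr fun s hs => ?_
    rw [h s hs]
  have hchoose {p q : (ℂ → ℂ) → Prop} (hpq : p = q) (hp : ∃ f, p f) (hq : ∃ f, q f) :
      hp.choose = hq.choose := by
    subst hpq
    rfl
  by_cases hex : ∃ f, IsContinuation k' K' χ' f
  · have hex' : ∃ f, IsContinuation k K χ f := by rwa [hcont]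
    rw [artinLFunction, artinLFunction, dif_pos hex, dif_pos hex']
    exact hchoose hcont hex' hex
  · have hex' : ¬ ∃ f, IsContinuation k K χ f := by rwa [hcont]
    rw [artinLFunction, artinLFunction, dif_neg hex, dif_neg hex']
    ext s
    split_ifs with hs
    · exact h s hs
    · rfl

end LFunctions

/-! ### Faithfulness of the induced character. -/

section Faithful

variable {k K K' : Type*} [Field k] [NumberField k] [Field K] [Algebra k K]
  [IsGalois k K] [Field K'] [NumberField K'] [Algebra k K'] [Algebra K K'] [IsScalarTower k K K']

theorem IsCharacter.inducedInflation {χ : Gal(K/k) → ℂ} (hχ : IsCharacter χ) :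
    IsCharacter (inducedInflation K' χ) :=
  (hχ.comp (AlgEquiv.restrictNormalHom K)).induced restrictScalarsHom_injective

theorem IsFaithful.inducedInflation [NumberField K] [Normal ℚ K'] [IsNormalClosure ℚ K K'] {χ : Gal(K/k) → ℂ}
    (hχ : IsCharacter χ) (h : IsFaithful χ) : IsFaithful (inducedInflation K' χ) := by
  intro g hg
  -- Faithfulness of `χ` makes `x⁻¹ * g * x` trivial on `K`, so `g` is trivial on `x(K)`.
  have hfix (x : Gal(K'/ℚ)) (y : K) : g (x (algebraMap K K' y)) = x (algebraMap K K' y) := by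
    obtain ⟨u, hu, hu1⟩ := exists_of_inducedCharacter_eq restrictScalarsHom_injective
      (hχ.comp (AlgEquiv.restrictNormalHom K)) hg x
    have hu2 : AlgEquiv.restrictNormalHom K u = 1 := h _ (by simpa using hu1)
    have hu3 : u (algebraMap K K' y) = algebraMap K K' y := by
      rw [← AlgEquiv.restrictNormal_commutes u K y]
      exact congrArg (fun τ : Gal(K/k) => algebraMap K K' (τ y)) hu2
    have hu4 : (x⁻¹ * g * x) (algebraMap K K' y) = algebraMap K K' y := by
      rw [← hu]
      exact hu3
    have := congrArg x hu4
    rwa [← AlgEquiv.mul_apply, ← mul_assoc, mul_inv_cancel_left] at this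
  have htop : (⊤ : IntermediateField ℚ K') ≤ IntermediateField.fixedField (Subgroup.zpowers g) := by
    rw [← IsNormalClosure.adjoin_rootSet (F := ℚ) (K := K) (L := K'), iSup_le_iff]
    intro y
    rw [IntermediateField.adjoin_le_iff]
    intro z hz
    rw [← minpoly.algebraMap_eq (algebraMap K K').injective] at hz
    -- `K'` is generated by the roots of minimal polynomials of elements `y` of `K`, and each root
    -- is a Galois conjugate of `y`.
    obtain ⟨x, hx⟩ := minpoly.exists_algEquiv_of_root' (K := ℚ) (y := algebraMap K K' y) (x := z)
      (Algebra.IsAlgebraic.isAlgebraic _) (Polynomial.mem_rootSet.mp hz).2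
    have hg : g ∈ MulAction.stabilizer Gal(K'/ℚ) z := by
      rw [MulAction.mem_stabilizer_iff, ← hx]
      exact hfix x y
    exact (IntermediateField.mem_fixedField_iff _ _).mpr fun f hf =>
      Subgroup.zpowers_le.mpr hg hf
  ext z
  have := (IntermediateField.mem_fixedField_iff _ _).mp (htop (IntermediateField.mem_top (x := z)))
  exact this g (Subgroup.mem_zpowers g)

end Faithful

end ArtinL

end

theorem proposition4 {k K K' : Type*} [Field k] [NumberField k] [Field K] [NumberField K]
    [Algebra k K] [IsGalois k K]
    [Field K'] [NumberField K'] [Algebra k K'] [Algebra K K'] [IsScalarTower k K K']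
    [IsGalois ℚ K'] [IsNormalClosure ℚ K K']
    (χ : Gal(K/k) → ℂ) (hχ : ArtinL.IsCharacter χ) (hfaithful : ArtinL.IsFaithful χ) :
    ArtinL.IsCharacter (ArtinL.inducedInflation K' χ) ∧
    ArtinL.IsFaithful (ArtinL.inducedInflation K' χ) ∧
    (∀ s : ℂ, 1 < s.re →
      HasProd (fun p => ArtinL.eulerFactor k K χ p s) (ArtinL.artinLFunction k K χ s) ∧
      HasProd (fun p => ArtinL.eulerFactor ℚ K' (ArtinL.inducedInflation K' χ) p s)
        (ArtinL.artinLFunction ℚ K' (ArtinL.inducedInflation K' χ) s)) ∧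
    ArtinL.artinLFunction k K χ =
      ArtinL.artinLFunction ℚ K' (ArtinL.inducedInflation K' χ) := by
  have : IsGalois k K' := IsGalois.tower_top_of_isGalois ℚ k K'
  have : IsGalois K K' := IsGalois.tower_top_of_isGalois ℚ K K'
  have hψ : ArtinL.IsCharacter (ArtinL.inducedInflation K' χ) := hχ.inducedInflation
  refine ⟨hψ, hfaithful.inducedInflation hχ, fun s hs => ?_,
    ArtinL.artinLFunction_congr fun s hs => ?_⟩
  · obtain ⟨a, h1, h2⟩ := ArtinL.exists_hasProd_eulerFactor hχ hψ hs
    rw [ArtinL.artinLFunction_eq_eulerProduct _ hs, ArtinL.artinLFunction_eq_eulerProduct _ hs]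
    exact ⟨h1.multipliable.hasProd, h2.multipliable.hasProd⟩
  · obtain ⟨a, h1, h2⟩ := ArtinL.exists_hasProd_eulerFactor hχ hψ hs
    exact h1.tprod_eq.trans h2.tprod_eq.symm
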